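/- Let $V$ be a finite-dimensional vector space over $\mathbb{Q}$ with a non-degenerate symmetric bilinear form $(\cdot,\cdot)$, and let $L\subseteq V$ be an even lattice, i.e., a finitely generated subgroup spanning $V$ over $\mathbb{Q}$ such that $(\lambda,\lambda)\in 2\mathbb{Z}$ for every $\lambda\in L$. Write $L^*=\{\nu\in V\mid(\nu,L)\subseteq\mathbb{Z}\}$, let $\mathrm{SO}^+(V_{\mathbb{R}})$ be the identity component of the orthogonal group $\mathrm{O}(V_{\mathbb{R}})$ of $V_{\mathbb{R}}=V\otimes_{\mathbb{Q}}\mathbb{R}$, and set \[\Gamma_L=\ker\big(\mathrm{Aut}(L)\to\mathrm{Aut}(L^*/L)\big)\cap\mathrm{SO}^+(V_{\mathbb{R}}),\] where $\mathrm{Aut}(L)$ is the group of elements of $\mathrm{O}(V)$ that map $L$ onto itself. Let $z\in L$ be a primitive vector (that is, if $z=nv$ with $v\in L$ and $n\in\mathbb{Z}$ then $n=\pm1$) that is isotropic, $(z,z)=0$. Put $I=\mathbb{Z}z$ and $U=\mathbb{Q}z$, let $\mathcal{P}^0_{U_{\mathbb{R}}}$ be the identity component of the stabilizer of $U_{\mathbb{R}}=\mathbb{R}z$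 in $\mathrm{O}(V_{\mathbb{R}})$, and set $\Gamma_{L,I}=\Gamma_L\cap\mathcal{P}^0_{U_{\mathbb{R}}}$. The space $W=U^\perp/U$ carries the induced non-degenerate bilinear form, and $\Lambda=(I^\perp\cap L)/I\subseteq W$ is an even lattice in $W$; let $\Gamma_\Lambda$ be the group defined from $\Lambda$ and $W$ in the same way as $\Gamma_L$ is defined from $L$ and $V$. Then $\Gamma_{L,I}$ is isomorphic to the semi-direct product $\Gamma_\Lambda\ltimes(\Lambda,+)$, in which $\Gamma_\Lambda$ acts on the additive group of $\Lambda$ by its natural action. -/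

import Mathlib

open scoped TensorProduct

namespace EvenLattice

section Field

variable {F : Type*} [Field F] {X : Type*} [AddCommGroup X] [Module F X]

/-- The orthogonal group `O(X)` of a bilinear form on `X`, as a subgroup of `GL(X)`. -/
def orthogonalGroup (B : LinearMap.BilinForm F X) :
    Subgroup (LinearMap.GeneralLinearGroup F X) where
  carrier := {g | ∀ x y : X, B ((g : Module.End F X) x) ((g : Module.End F X) y) = B x y}
  one_mem' := fun _ _ => rfl
  mul_mem' := by
    intro g h hg hh x y
    have e := hg ((h : Module.End F X) x) ((h : Module.End F X) y)
    exact e.trans (hh x y)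
  inv_mem' := by
    intro g hg x y
    have key : ∀ v : X, (g : Module.End F X) (((g⁻¹ : LinearMap.GeneralLinearGroup F X) :
        Module.End F X) v) = v := fun v => by
      rw [← Module.End.mul_apply, Units.mul_inv, Module.End.one_apply]
    rw [← hg, key, key]

/-- The stabilizer in `GL(X)` of an additive subgroup `M` of `X`: all `g` with `g M = M`. -/
def setwiseStabilizer (F : Type*) [Field F] {X : Type*} [AddCommGroup X] [Module F X]
    (M : AddSubgroup X) : Subgroup (LinearMap.GeneralLinearGroup F X) where
  carrier := {g | (fun x => (g : Module.End F X) x) '' (M : Set X) = M}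
  one_mem' := by
    change (fun x : X => x) '' (M : Set X) = M
    exact Set.image_id _
  mul_mem' := by
    intro g h hg hh
    have e : (fun x => ((g * h : LinearMap.GeneralLinearGroup F X) : Module.End F X) x)
        = (fun x => (g : Module.End F X) x) ∘ (fun x => (h : Module.End F X) x) := rfl
    change _ '' _ = _ at hg hh ⊢
    rw [e, Set.image_comp, hh, hg]
  inv_mem' := by
    intro g hg
    change _ '' _ = _ at hg ⊢
    conv_lhs => rw [← hg]
    rw [← Set.image_comp]
    have e : (fun x => ((g⁻¹ : LinearMap.GeneralLinearGroup F X) : Module.End F X) x) ∘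
        (fun x => (g : Module.End F X) x) = id := by
      funext v
      change (((g⁻¹ : LinearMap.GeneralLinearGroup F X) : Module.End F X) *
        (g : Module.End F X)) v = v
      rw [Units.inv_mul, Module.End.one_apply]
    rw [e, Set.image_id]

/-- The group `P_U`, the stabilizer of the subspace `U` in the orthogonal group `O(X)`. -/
def parabolic (B : LinearMap.BilinForm F X) (U : Submodule F X) :
    Subgroup (LinearMap.GeneralLinearGroup F X) :=
  orthogonalGroup B ⊓ setwiseStabilizer F U.toAddSubgroup

/-- The space `W = U^⊥ / U`, for an isotropic subspace `U` (for an arbitrary subspace `U` this is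
the quotient of `U^⊥` by `U ∩ U^⊥`). -/
abbrev perpQuotient (B : LinearMap.BilinForm F X) (U : Submodule F X) : Type _ :=
  ↥(B.orthogonal U) ⧸ U.submoduleOf (B.orthogonal U)

/-- The bilinear form on `W = U^⊥ / U` induced by that of `X`. -/
def perpQuotientForm (B : LinearMap.BilinForm F X) (hB : B.IsSymm) (U : Submodule F X) :
    LinearMap.BilinForm F (perpQuotient B U) :=
  (U.submoduleOf (B.orthogonal U)).liftQ
    (LinearMap.flip ((U.submoduleOf (B.orthogonal U)).liftQ
      (LinearMap.flip (B.restrict (B.orthogonal U)))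
      (by
        intro u hu
        ext v
        change B v u = 0
        rw [show B (v : X) (u : X) = B u v from hB.eq v u]
        exact v.2 u hu)))
    (by
      intro u hu
      ext v
      change B u v = 0
      exact v.2 u hu)

@[simp]
theorem perpQuotientForm_mk (B : LinearMap.BilinForm F X) (hB : B.IsSymm) (U : Submodule F X)
    (v w : ↥(B.orthogonal U)) :
    perpQuotientForm B hB U (Submodule.Quotient.mk v) (Submodule.Quotient.mk w) =
      B (v : X) (w : X) :=
  rfl

end Field

/-- The identity component of a group `G` of linear automorphisms of a finite-dimensional real
vector space `X`. Here `End(X)` carries its usual topology (the module topology of a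
finite-dimensional real vector space), `GL(X) = End(X)ˣ` the corresponding topology of the unit
group, and `G` the subspace topology. -/
noncomputable def identityComponent {X : Type*} [AddCommGroup X] [Module ℝ X]
    [FiniteDimensional ℝ X] (G : Subgroup (LinearMap.GeneralLinearGroup ℝ X)) :
    Subgroup (LinearMap.GeneralLinearGroup ℝ X) :=
  letI : TopologicalSpace (Module.End ℝ X) := moduleTopology ℝ (Module.End ℝ X)
  haveI : IsModuleTopology ℝ (Module.End ℝ X) := ⟨rfl⟩
  haveI : IsTopologicalRing (Module.End ℝ X) :=
    IsModuleTopology.isTopologicalRing ℝ (Module.End ℝ X)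
  letI : TopologicalSpace (LinearMap.GeneralLinearGroup ℝ X) :=
    inferInstanceAs (TopologicalSpace (Module.End ℝ X)ˣ)
  haveI : IsTopologicalGroup (LinearMap.GeneralLinearGroup ℝ X) :=
    inferInstanceAs (IsTopologicalGroup (Module.End ℝ X)ˣ)
  (Subgroup.connectedComponentOfOne G).map G.subtype

section Rational

variable {V : Type*} [AddCommGroup V] [Module ℚ V]

/-- The extension of scalars `GL(V) → GL(V_ℝ)`, where `V_ℝ = ℝ ⊗ V`. -/
noncomputable def realExtension (V : Type*) [AddCommGroup V] [Module ℚ V] :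
    LinearMap.GeneralLinearGroup ℚ V →* LinearMap.GeneralLinearGroup ℝ (ℝ ⊗[ℚ] V) :=
  Units.map (Module.End.baseChangeHom ℚ ℝ V : Module.End ℚ V →* Module.End ℝ (ℝ ⊗[ℚ] V))

/-- `L` is an even lattice in the rational quadratic space `(V, B)`: a finitely generated subgroup
of full rank such that `(λ, λ)` is an even integer for every `λ ∈ L`. -/
structure IsEvenLattice (B : LinearMap.BilinForm ℚ V) (L : Submodule ℤ V) : Prop where
  fg : L.FG
  span_eq_top : Submodule.span ℚ (L : Set V) = ⊤
  even : ∀ x ∈ L, ∃ n : ℤ, B x x = 2 * (n : ℚ)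

/-- `z` is a primitive vector of `L`: it is not a proper multiple of an element of `L`. (In
particular `z ≠ 0`, since `0 = 0 • 0`.) -/
def IsPrimitive (L : Submodule ℤ V) (z : V) : Prop :=
  z ∈ L ∧ ∀ v ∈ L, ∀ n : ℤ, z = n • v → IsUnit n

/-- The discriminant kernel in the full automorphism group of `L`: those `g ∈ O(V)` with `g L = L`
which act trivially on the discriminant group `L^* / L`. -/
def discriminantKernel (B : LinearMap.BilinForm ℚ V) (L : Submodule ℤ V) :
    Subgroup (LinearMap.GeneralLinearGroup ℚ V) where
  carrier := {g | g ∈ orthogonalGroup B ⊓ setwiseStabilizer ℚ L.toAddSubgroup ∧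
    ∀ ν ∈ B.dualSubmodule L, (g : Module.End ℚ V) ν - ν ∈ L}
  one_mem' := ⟨one_mem _, fun ν _ => by simp⟩
  mul_mem' := by
    rintro g h ⟨hg, hg'⟩ ⟨hh, hh'⟩
    refine ⟨mul_mem hg hh, fun ν hν => ?_⟩
    have h1 : (g : Module.End ℚ V) ((h : Module.End ℚ V) ν - ν) ∈ L := by
      have e : (fun x => (g : Module.End ℚ V) x) '' (L : Set V) = L := hg.2
      have : (g : Module.End ℚ V) ((h : Module.End ℚ V) ν - ν) ∈ (L : Set V) := by
        rw [← e]
        exact ⟨_, hh' ν hν, rfl⟩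
      exact this
    have h2 := L.add_mem h1 (hg' ν hν)
    rw [map_sub, sub_add_sub_cancel] at h2
    exact h2
  inv_mem' := by
    rintro g ⟨hg, hg'⟩
    refine ⟨inv_mem hg, fun ν hν => ?_⟩
    have hi := (inv_mem hg).2
    have e : (fun x => ((g⁻¹ : LinearMap.GeneralLinearGroup ℚ V) : Module.End ℚ V) x) ''
      (L : Set V) = L := hi
    have h1 : ((g⁻¹ : LinearMap.GeneralLinearGroup ℚ V) : Module.End ℚ V)
        ((g : Module.End ℚ V) ν - ν) ∈ (L : Set V) := by
      rw [← e]
      exact ⟨_, hg' ν hν, rfl⟩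
    have h2 : ((g⁻¹ : LinearMap.GeneralLinearGroup ℚ V) : Module.End ℚ V)
        ((g : Module.End ℚ V) ν) = ν := by
      rw [← Module.End.mul_apply, Units.inv_mul, Module.End.one_apply]
    rw [map_sub, h2] at h1
    have h3 := L.neg_mem h1
    rwa [neg_sub] at h3

variable [FiniteDimensional ℚ V]

/-- The group `Γ_L = ker(Aut(L) → Aut(L^* / L)) ∩ SO⁺(V_ℝ)`, where `SO⁺(V_ℝ)` is the identity
component of `O(V_ℝ)`. -/
noncomputable def Gamma (B : LinearMap.BilinForm ℚ V) (L : Submodule ℤ V) :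
    Subgroup (LinearMap.GeneralLinearGroup ℚ V) :=
  discriminantKernel B L ⊓
    (identityComponent (orthogonalGroup (B.baseChange ℝ))).comap (realExtension V)

/-- The group `Γ_{L,I} = Γ_L ∩ P⁰`, where `P⁰` is the identity component of the stabilizer in
`O(V_ℝ)` of `U_ℝ`, for `U = I_ℚ`. -/
noncomputable def GammaParabolic (B : LinearMap.BilinForm ℚ V) (L I : Submodule ℤ V) :
    Subgroup (LinearMap.GeneralLinearGroup ℚ V) :=
  Gamma B L ⊓
    (identityComponent (parabolic (B.baseChange ℝ)
      ((Submodule.span ℚ (I : Set V)).baseChange ℝ))).comap (realExtension V)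

/-- The natural action of `Γ_L` on the additive group of `L`. -/
noncomputable def latticeAction (B : LinearMap.BilinForm ℚ V) (L : Submodule ℤ V) :
    ↥(Gamma B L) →* MulAut (Multiplicative ↥L) where
  toFun g := AddEquiv.toMultiplicative
    { toFun := fun x => ⟨((g : LinearMap.GeneralLinearGroup ℚ V) : Module.End ℚ V) x, by
        have e : (fun x => ((g : LinearMap.GeneralLinearGroup ℚ V) : Module.End ℚ V) x) ''
          (L : Set V) = L := g.2.1.1.2
        have : ((g : LinearMap.GeneralLinearGroup ℚ V) : Module.End ℚ V) x ∈ (L : Set V) := by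
          rw [← e]
          exact ⟨_, x.2, rfl⟩
        exact this⟩
      invFun := fun x =>
        ⟨((g⁻¹ : LinearMap.GeneralLinearGroup ℚ V) : Module.End ℚ V) x, by
          have e : (fun x => ((g⁻¹ : LinearMap.GeneralLinearGroup ℚ V) : Module.End ℚ V) x) ''
            (L : Set V) = L := (inv_mem g.2).1.1.2
          have : ((g⁻¹ : LinearMap.GeneralLinearGroup ℚ V) : Module.End ℚ V) x ∈ (L : Set V) := by
            rw [← e]
            exact ⟨_, x.2, rfl⟩
          exact this⟩
      left_inv := fun x => Subtype.ext (by
        change (((g⁻¹ : LinearMap.GeneralLinearGroup ℚ V) : Module.End ℚ V) *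
          ((g : LinearMap.GeneralLinearGroup ℚ V) : Module.End ℚ V)) (x : V) = x
        rw [Units.inv_mul, Module.End.one_apply])
      right_inv := fun x => Subtype.ext (by
        change (((g : LinearMap.GeneralLinearGroup ℚ V) : Module.End ℚ V) *
          ((g⁻¹ : LinearMap.GeneralLinearGroup ℚ V) : Module.End ℚ V)) (x : V) = x
        rw [Units.mul_inv, Module.End.one_apply])
      map_add' := fun x y => Subtype.ext (map_add _ (x : V) (y : V)) }
  map_one' := rfl
  map_mul' _ _ := rfl

/-- The lattice `Λ = (I^⊥ ∩ L) / I` in `W = U^⊥ / U`, for `U = I_ℚ`: the image of `U^⊥ ∩ L` under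
the projection `U^⊥ → W`. -/
def perpLattice (B : LinearMap.BilinForm ℚ V) (L I : Submodule ℤ V) :
    Submodule ℤ (perpQuotient B (Submodule.span ℚ (I : Set V))) :=
  (L.comap ((B.orthogonal (Submodule.span ℚ (I : Set V))).subtype.restrictScalars ℤ)).map
    (((Submodule.span ℚ (I : Set V)).submoduleOf
      (B.orthogonal (Submodule.span ℚ (I : Set V)))).mkQ.restrictScalars ℤ)

end Rational

end EvenLattice

/-! Since `z` is primitive, it pairs to 1 with some `z₀` in the dual lattice, and `z' = z₀ - (z₀,
z₀)/2 • z` completes `z` to a hyperbolic pair. So over ℚ the space is the orthogonal sum of a copy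
of `W` and a hyperbolic plane. The lattice `L` itself need not split, but `Λ` is still the set of
`y` with `ι y ∈ L`, because `z'` differs from a dual vector by a multiple of `z`.

An isometry fixing `z` is uniquely an Eichler transvection with parameter `y ∈ W` times an isometry
`h` of `W` extended by the identity (`eq_siegel_mul_lift`, `siegel_mul_lift_injective`), and
conjugation by `h` sends `y` to `h y`. The product lies in the discriminant kernel of `L` exactly
when `y ∈ Λ` and `h` lies in that of `Λ`: evenness makes the transvections integral, and conversely
dual vectors of `Λ` lift to dual vectors of `L` orthogonal to `z` (`exists_dual_lift`).

For the real condition, an element of `P⁰` scales `z` by a positive factor. For a lattice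
automorphism this factor is an integer with integral inverse, hence 1 (`apply_z_eq`). Reduction to
`W` and extension from `W` are affine on endomorphisms, hence continuous, and transvections lie on
one-parameter groups, so the identity components match. -/

namespace EvenLattice

/-! ### Hyperbolic splittings and the stabilizer of an isotropic line -/

/-- A decomposition of the quadratic space `X` as the orthogonal sum of a quadratic space `Y` and
the hyperbolic plane spanned by `z` and `z'`, given by the inclusion `ι` of `Y` and the
projection `π` onto `Y`. -/
structure HyperbolicSplitting {F : Type*} [Field F] {X Y : Type*} [AddCommGroup X] [Module F X]
    [AddCommGroup Y] [Module F Y] (B : LinearMap.BilinForm F X) (C : LinearMap.BilinForm F Y)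
    (z z' : X) (ι : Y →ₗ[F] X) (π : X →ₗ[F] Y) : Prop where
  symm : B.IsSymm
  zz : B z z = 0
  zz' : B z z' = 1
  z'z' : B z' z' = 0
  ιz : ∀ y, B (ι y) z = 0
  ιz' : ∀ y, B (ι y) z' = 0
  ιι : ∀ y y', B (ι y) (ι y') = C y y'
  πz : π z = 0
  πz' : π z' = 0
  πι : ∀ y, π (ι y) = y
  decomp : ∀ x, x = ι (π x) + B x z' • z + B x z • z'

namespace HyperbolicSplitting

section Field

variable {F : Type*} [Field F] {X Y : Type*} [AddCommGroup X] [Module F X]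
  [AddCommGroup Y] [Module F Y] {B : LinearMap.BilinForm F X} {C : LinearMap.BilinForm F Y}
  {z z' : X} {ι : Y →ₗ[F] X} {π : X →ₗ[F] Y}

theorem comm (S : HyperbolicSplitting B C z z' ι π) (x y : X) : B x y = B y x :=
  S.symm.eq x y

theorem zι (S : HyperbolicSplitting B C z z' ι π) (y : Y) : B z (ι y) = 0 := by
  rw [S.comm z]; exact S.ιz y

theorem z'ι (S : HyperbolicSplitting B C z z' ι π) (y : Y) : B z' (ι y) = 0 := by
  rw [S.comm z']; exact S.ιz' y

theorem z'z (S : HyperbolicSplitting B C z z' ι π) : B z' z = 1 := by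
  rw [S.comm z']; exact S.zz'

theorem form_comm (S : HyperbolicSplitting B C z z' ι π) (x y : Y) : C x y = C y x := by
  rw [← S.ιι, ← S.ιι, S.comm]

theorem ne_zero (S : HyperbolicSplitting B C z z' ι π) : z ≠ 0 := by
  rintro rfl
  simpa using S.zz'

/-- The hyperbolic plane is orthogonal to the image of `ι`, so `π` is the adjoint of `ι`. Over
lattices this makes `π` carry dual vectors to dual vectors. -/
theorem form_proj (S : HyperbolicSplitting B C z z' ι π) (v : X) (w : Y) :
    C (π v) w = B v (ι w) := by
  conv_rhs => rw [S.decomp v]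
  simp [S.ιι, S.zι, S.z'ι]

theorem ι_proj_of_perp (S : HyperbolicSplitting B C z z' ι π) {v : X} (hv : B v z = 0) :
    ι (π v) = v - B v z' • z := by
  conv_rhs => lhs; rw [S.decomp v]
  simp [hv]

theorem hom_ext (S : HyperbolicSplitting B C z z' ι π) {M : Type*} [AddCommGroup M] [Module F M]
    {f g : X →ₗ[F] M} (h1 : ∀ y, f (ι y) = g (ι y)) (h2 : f z = g z) (h3 : f z' = g z') :
    f = g := by
  ext x
  rw [S.decomp x]
  simp [h1, h2, h3]

theorem isometry_of (S : HyperbolicSplitting B C z z' ι π) {f : X →ₗ[F] X}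
    (h1 : ∀ x y, B (f (ι x)) (f (ι y)) = C x y) (h2 : ∀ x, B (f (ι x)) (f z) = 0)
    (h3 : ∀ x, B (f (ι x)) (f z') = 0) (h4 : B (f z) (f z) = 0) (h5 : B (f z) (f z') = 1)
    (h6 : B (f z') (f z') = 0) (x y : X) : B (f x) (f y) = B x y := by
  have e : B.compl₁₂ f f = B := by
    refine S.hom_ext (fun a => S.hom_ext (fun b => ?_) ?_ ?_)
      (S.hom_ext (fun b => ?_) ?_ ?_) (S.hom_ext (fun b => ?_) ?_ ?_) <;>
    simp only [LinearMap.compl₁₂_apply]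
    · rw [h1, S.ιι]
    · rw [h2, S.ιz]
    · rw [h3, S.ιz']
    · rw [S.comm, h2, S.zι]
    · rw [h4, S.zz]
    · rw [h5, S.zz']
    · rw [S.comm, h3, S.z'ι]
    · rw [S.comm, h5, S.z'z]
    · rw [h6, S.z'z']
  exact congr($e x y)

/-- The extension of an endomorphism of `Y` to `X` by the identity on the hyperbolic plane. -/
def liftEnd (_ : HyperbolicSplitting B C z z' ι π) (a : Module.End F Y) : Module.End F X :=
  ι ∘ₗ a ∘ₗ π + ((B.flip z').smulRight z + (B.flip z).smulRight z')

theorem liftEnd_apply (S : HyperbolicSplitting B C z z' ι π) (a : Module.End F Y) (x : X) :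
    S.liftEnd a x = ι (a (π x)) + (B x z' • z + B x z • z') := rfl

theorem liftEnd_ι (S : HyperbolicSplitting B C z z' ι π) (a : Module.End F Y) (y : Y) :
    S.liftEnd a (ι y) = ι (a y) := by
  simp [liftEnd_apply, S.πι, S.ιz, S.ιz']

theorem liftEnd_z (S : HyperbolicSplitting B C z z' ι π) (a : Module.End F Y) :
    S.liftEnd a z = z := by
  simp [liftEnd_apply, S.πz, S.zz, S.zz']

theorem liftEnd_z' (S : HyperbolicSplitting B C z z' ι π) (a : Module.End F Y) :
    S.liftEnd a z' = z' := by
  simp [liftEnd_apply, S.πz', S.z'z, S.z'z']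

/-- The embedding `GL(Y) → GL(X)` by the identity on the hyperbolic plane. -/
def lift (S : HyperbolicSplitting B C z z' ι π) :
    LinearMap.GeneralLinearGroup F Y →* LinearMap.GeneralLinearGroup F X :=
  Units.map
    { toFun := S.liftEnd
      map_one' := S.hom_ext (fun y => by simp [S.liftEnd_ι]) (by simp [S.liftEnd_z])
        (by simp [S.liftEnd_z'])
      map_mul' := fun a b => S.hom_ext (fun y => by simp [S.liftEnd_ι]) (by simp [S.liftEnd_z])
        (by simp [S.liftEnd_z']) }

@[simp]
theorem coe_lift (S : HyperbolicSplitting B C z z' ι π) (h : LinearMap.GeneralLinearGroup F Y) :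
    (S.lift h : Module.End F X) = S.liftEnd (h : Module.End F Y) := rfl

theorem lift_mem_orthogonalGroup (S : HyperbolicSplitting B C z z' ι π)
    {h : LinearMap.GeneralLinearGroup F Y} (hh : h ∈ orthogonalGroup C) :
    S.lift h ∈ orthogonalGroup B := by
  refine S.isometry_of (fun x y => ?_) (fun x => ?_) (fun x => ?_) ?_ ?_ ?_ <;>
  simp only [coe_lift, S.liftEnd_ι, S.liftEnd_z, S.liftEnd_z', S.ιz, S.ιz', S.zz, S.zz', S.z'z',
    S.ιι]
  exact hh x y

/-- The Eichler transvection attached to the isotropic vector `z` and to `ι y`. -/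
def siegelEnd (_ : HyperbolicSplitting B C z z' ι π) (y : Y) : Module.End F X :=
  1 + (B.flip z).smulRight (ι y) - (B.flip (ι y)).smulRight z
    - (2⁻¹ * C y y) • (B.flip z).smulRight z

theorem siegelEnd_apply (S : HyperbolicSplitting B C z z' ι π) (y : Y) (x : X) :
    S.siegelEnd y x = x + B x z • ι y - B x (ι y) • z - (2⁻¹ * C y y) • B x z • z := rfl

theorem siegelEnd_ι (S : HyperbolicSplitting B C z z' ι π) (y x : Y) :
    S.siegelEnd y (ι x) = ι x - C x y • z := by
  simp [siegelEnd_apply, S.ιz, S.ιι]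

theorem siegelEnd_z (S : HyperbolicSplitting B C z z' ι π) (y : Y) :
    S.siegelEnd y z = z := by
  simp [siegelEnd_apply, S.zz, S.zι]

theorem siegelEnd_z' (S : HyperbolicSplitting B C z z' ι π) (y : Y) :
    S.siegelEnd y z' = z' + ι y - (2⁻¹ * C y y) • z := by
  simp [siegelEnd_apply, S.z'z, S.z'ι]

/-- The quadratic coefficients differ by the cross term `C x y`, which arises when the transvection
of `x` moves `ι y` by `-C y x • z`. -/
theorem siegelEnd_add [CharZero F] (S : HyperbolicSplitting B C z z' ι π) (x y : Y) :
    S.siegelEnd (x + y) = S.siegelEnd x * S.siegelEnd y := by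
  refine S.hom_ext (fun w => ?_) ?_ ?_
  · simp only [Module.End.mul_apply, S.siegelEnd_ι, map_sub, map_smul, S.siegelEnd_z, map_add]
    module
  · simp only [Module.End.mul_apply, S.siegelEnd_z]
  · simp only [Module.End.mul_apply, S.siegelEnd_ι, S.siegelEnd_z, S.siegelEnd_z', map_sub,
      map_smul, map_add, LinearMap.add_apply, S.form_comm y x]
    module

/-- The Eichler transvections attached to `z`, as a homomorphism from the additive group
of `Y`. -/
def siegel [CharZero F] (S : HyperbolicSplitting B C z z' ι π) :
    Multiplicative Y →* LinearMap.GeneralLinearGroup F X :=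
  MonoidHom.toHomUnits
    { toFun := fun y => S.siegelEnd y.toAdd
      map_one' := S.hom_ext (fun y => by simp [S.siegelEnd_ι]) (by simp [S.siegelEnd_z])
        (by simp [S.siegelEnd_z'])
      map_mul' := fun x y => S.siegelEnd_add x.toAdd y.toAdd }

@[simp]
theorem coe_siegel [CharZero F] (S : HyperbolicSplitting B C z z' ι π) (y : Multiplicative Y) :
    (S.siegel y : Module.End F X) = S.siegelEnd y.toAdd := rfl

theorem siegel_mem_orthogonalGroup [CharZero F] (S : HyperbolicSplitting B C z z' ι π)
    (y : Multiplicative Y) : S.siegel y ∈ orthogonalGroup B := by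
  refine S.isometry_of (fun x w => ?_) (fun x => ?_) (fun x => ?_) ?_ ?_ ?_ <;>
  simp only [coe_siegel, S.siegelEnd_ι, S.siegelEnd_z, S.siegelEnd_z', map_sub, map_smul, map_add,
    LinearMap.sub_apply, LinearMap.smul_apply, LinearMap.add_apply, S.ιz, S.ιz', S.zι, S.z'ι,
    S.zz, S.zz', S.z'z, S.z'z', S.ιι, smul_eq_mul] <;>
  ring

theorem lift_mul_siegel_mul_inv [CharZero F] (S : HyperbolicSplitting B C z z' ι π)
    {h : LinearMap.GeneralLinearGroup F Y} (hh : h ∈ orthogonalGroup C) (y : Y) :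
    S.lift h * S.siegel (Multiplicative.ofAdd y) * (S.lift h)⁻¹ =
      S.siegel (Multiplicative.ofAdd ((h : Module.End F Y) y)) := by
  rw [mul_inv_eq_iff_eq_mul]
  refine Units.ext (S.hom_ext (fun w => ?_) ?_ ?_)
  · simp [S.liftEnd_ι, S.siegelEnd_ι, S.liftEnd_z, hh w y]
  · simp [S.liftEnd_z, S.siegelEnd_z]
  · simp [S.liftEnd_ι, S.siegelEnd_z', S.liftEnd_z, S.liftEnd_z', hh y y]

theorem mem_parabolic_of_fix {g : LinearMap.GeneralLinearGroup F X}
    (hg : g ∈ orthogonalGroup B) (hz : (g : Module.End F X) z = z) :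
    g ∈ parabolic B (Submodule.span F {z}) := by
  refine ⟨hg, ?_⟩
  change (g : Module.End F X) '' (Submodule.span F {z} : Set X) = (Submodule.span F {z} : Set X)
  rw [← Submodule.map_coe, Submodule.map_span, Set.image_singleton, hz]

theorem lift_mem_parabolic (S : HyperbolicSplitting B C z z' ι π)
    {h : LinearMap.GeneralLinearGroup F Y} (hh : h ∈ orthogonalGroup C) :
    S.lift h ∈ parabolic B (Submodule.span F {z}) :=
  mem_parabolic_of_fix (S.lift_mem_orthogonalGroup hh) (S.liftEnd_z _)

theorem siegel_mem_parabolic [CharZero F] (S : HyperbolicSplitting B C z z' ι π)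
    (y : Multiplicative Y) : S.siegel y ∈ parabolic B (Submodule.span F {z}) :=
  mem_parabolic_of_fix (S.siegel_mem_orthogonalGroup y) (S.siegelEnd_z _)

/-- Writing the eigenvalue as a pairing with `z'` makes it a linear functional of `g`, as the later
sign argument requires. -/
theorem apply_eq_smul_of_mem_parabolic (S : HyperbolicSplitting B C z z' ι π)
    {g : LinearMap.GeneralLinearGroup F X} (hg : g ∈ parabolic B (Submodule.span F {z})) :
    (g : Module.End F X) z = B ((g : Module.End F X) z) z' • z := by
  have h : (g : Module.End F X) '' (Submodule.span F {z} : Set X) =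
    (Submodule.span F {z} : Set X) := hg.2
  have h1 : (g : Module.End F X) z ∈ (Submodule.span F {z} : Set X) := by
    rw [← h]
    exact ⟨z, Submodule.mem_span_singleton_self z, rfl⟩
  obtain ⟨c, hc⟩ := Submodule.mem_span_singleton.1 h1
  rw [← hc]
  simp [S.zz']

theorem coeff_ne_zero_of_mem_parabolic (S : HyperbolicSplitting B C z z' ι π)
    {g : LinearMap.GeneralLinearGroup F X} (hg : g ∈ parabolic B (Submodule.span F {z})) :
    B ((g : Module.End F X) z) z' ≠ 0 := by
  intro h
  have h1 := S.apply_eq_smul_of_mem_parabolic hg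
  rw [h, zero_smul] at h1
  apply S.ne_zero
  have h2 : ((g⁻¹ : LinearMap.GeneralLinearGroup F X) : Module.End F X)
      ((g : Module.End F X) z) = z := by
    rw [← Module.End.mul_apply, Units.inv_mul, Module.End.one_apply]
  rw [← h2, h1, map_zero]

theorem perp_of_mem_parabolic (S : HyperbolicSplitting B C z z' ι π)
    {g : LinearMap.GeneralLinearGroup F X} (hg : g ∈ parabolic B (Submodule.span F {z}))
    {v : X} (hv : B v z = 0) : B ((g : Module.End F X) v) z = 0 := by
  have h := hg.1 v z
  rw [S.apply_eq_smul_of_mem_parabolic hg, map_smul, smul_eq_mul, hv] at h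
  exact (mul_eq_zero.1 h).resolve_left (S.coeff_ne_zero_of_mem_parabolic hg)

/-- On `z^⊥`, `ι ∘ π` changes a vector only by a multiple of `z`, and `g` keeps that multiple in the
kernel of `π`. This makes `reduce` multiplicative. -/
theorem proj_apply_of_mem_parabolic (S : HyperbolicSplitting B C z z' ι π)
    {g : LinearMap.GeneralLinearGroup F X} (hg : g ∈ parabolic B (Submodule.span F {z}))
    {v : X} (hv : B v z = 0) :
    π ((g : Module.End F X) (ι (π v))) = π ((g : Module.End F X) v) := by
  rw [S.ι_proj_of_perp hv, map_sub, map_smul, S.apply_eq_smul_of_mem_parabolic hg]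
  simp [S.πz]

/-- The homomorphism from the stabilizer of the isotropic line spanned by `z` to `GL(Y)`. -/
def reduce (S : HyperbolicSplitting B C z z' ι π) :
    ↥(parabolic B (Submodule.span F {z})) →* LinearMap.GeneralLinearGroup F Y :=
  MonoidHom.toHomUnits
    { toFun := fun g => π ∘ₗ ((g : LinearMap.GeneralLinearGroup F X) : Module.End F X) ∘ₗ ι
      map_one' := LinearMap.ext fun y => S.πι y
      map_mul' := fun g h => LinearMap.ext fun y =>
        (S.proj_apply_of_mem_parabolic g.2 (S.perp_of_mem_parabolic h.2 (S.ιz y))).symm }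

@[simp]
theorem coe_reduce (S : HyperbolicSplitting B C z z' ι π)
    (g : ↥(parabolic B (Submodule.span F {z}))) :
    (S.reduce g : Module.End F Y) =
      π ∘ₗ ((g : LinearMap.GeneralLinearGroup F X) : Module.End F X) ∘ₗ ι := rfl

theorem reduce_mem_orthogonalGroup (S : HyperbolicSplitting B C z z' ι π)
    (g : ↥(parabolic B (Submodule.span F {z}))) : S.reduce g ∈ orthogonalGroup C := by
  intro x y
  have hx := S.perp_of_mem_parabolic g.2 (S.ιz x)
  have hy := S.perp_of_mem_parabolic g.2 (S.ιz y)
  have e := g.2.1 (ι x) (ι y)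
  simp only [coe_reduce, LinearMap.comp_apply]
  rw [S.form_proj, S.ι_proj_of_perp hy, map_sub, map_smul, hx, e, S.ιι]
  simp

/-- Because `g` fixes `z`, the vector `g z'` has `z'`-coefficient 1. Its `z`-coefficient is forced
by isotropy, and that of `g (ι y)` by orthogonality to `g z'`, so `π (g z')` and the reduction
determine `g`. -/
theorem eq_siegel_mul_lift [CharZero F] (S : HyperbolicSplitting B C z z' ι π)
    (g : ↥(parabolic B (Submodule.span F {z})))
    (hz : ((g : LinearMap.GeneralLinearGroup F X) : Module.End F X) z = z) :
    (g : LinearMap.GeneralLinearGroup F X) =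
      S.siegel (Multiplicative.ofAdd
        (π (((g : LinearMap.GeneralLinearGroup F X) : Module.End F X) z'))) *
        S.lift (S.reduce g) := by
  obtain ⟨g, hg⟩ := g
  simp only at hz
  have e1 := hg.1 z' z'
  have e2 := hg.1 z' z
  rw [hz, S.z'z] at e2
  have d := S.decomp ((g : Module.End F X) z')
  rw [e2, one_smul] at d
  refine Units.ext (S.hom_ext (fun y => ?_) ?_ ?_)
  · have hp := S.perp_of_mem_parabolic hg (S.ιz y)
    have d' := S.decomp ((g : Module.End F X) (ι y))
    have e3 := hg.1 (ι y) z'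
    simp only [Units.val_mul, coe_lift, coe_siegel, Module.End.mul_apply, S.liftEnd_ι,
      S.siegelEnd_ι, coe_reduce, LinearMap.comp_apply, toAdd_ofAdd]
    rw [hp, zero_smul, add_zero] at d'
    rw [S.form_proj]
    -- Expand `B (g (ι y)) (g z') = 0` along the decomposition of `g z'`.
    have e4 : B ((g : Module.End F X) (ι y)) (ι (π ((g : Module.End F X) z'))) =
        - B ((g : Module.End F X) (ι y)) z' := by
      rw [S.ιz', d, map_add, map_add, map_smul, hp] at e3
      simp only [smul_zero, add_zero] at e3
      exact eq_neg_of_add_eq_zero_left e3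
    rw [e4, neg_smul, sub_neg_eq_add]
    exact d'
  · simp [S.liftEnd_z, S.siegelEnd_z, hz]
  · simp only [Units.val_mul, coe_lift, coe_siegel, Module.End.mul_apply, S.liftEnd_z',
      S.siegelEnd_z', toAdd_ofAdd]
    set w := π ((g : Module.End F X) z')
    set c := B ((g : Module.End F X) z') z'
    rw [d, S.z'z'] at e1
    simp only [map_add, map_smul, LinearMap.add_apply, LinearMap.smul_apply, S.ιι, S.ιz, S.ιz',
      S.zι, S.z'ι, S.zz, S.zz', S.z'z, S.z'z', smul_eq_mul] at e1
    -- Isotropy of `g z' = ι w + c • z + z'` reads `C w w + 2c = 0`.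
    have e2 : c = - (2⁻¹ * C w w) := by
      field_simp
      linear_combination e1
    rw [d, e2]
    module

/-- Modulo the kernel of `π`, the product sends `z'` to `y` and `ι x` to `h x`. -/
theorem siegel_mul_lift_injective [CharZero F] (S : HyperbolicSplitting B C z z' ι π)
    {y : Y} {h : LinearMap.GeneralLinearGroup F Y}
    (e : S.siegel (Multiplicative.ofAdd y) * S.lift h = 1) : y = 0 ∧ h = 1 := by
  have e' : ∀ x, π (S.siegelEnd y (S.liftEnd (h : Module.End F Y) x)) = π x := fun x => by
    have := congr(π (Units.val $e x))
    simpa using this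
  constructor
  · simpa [S.liftEnd_z', S.siegelEnd_z', S.πz, S.πz', S.πι] using e' z'
  · refine Units.ext (LinearMap.ext fun x => ?_)
    simpa [S.liftEnd_ι, S.siegelEnd_ι, S.πz, S.πz', S.πι] using e' (ι x)

end Field

end HyperbolicSplitting

/-! ### Identity components of real linear groups -/

section Topology

variable {X Y : Type*} [AddCommGroup X] [Module ℝ X] [FiniteDimensional ℝ X]
  [AddCommGroup Y] [Module ℝ Y] [FiniteDimensional ℝ Y]

/-- The component of 1 in the subspace `G` is moved to the ambient group, where monotonicity and
images of connected sets apply directly. -/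
theorem mem_identityComponent_iff [t : TopologicalSpace (Module.End ℝ X)]
    [IsModuleTopology ℝ (Module.End ℝ X)]
    {G : Subgroup (LinearMap.GeneralLinearGroup ℝ X)} {g : LinearMap.GeneralLinearGroup ℝ X} :
    g ∈ identityComponent G ↔
      g ∈ connectedComponentIn (G : Set (LinearMap.GeneralLinearGroup ℝ X)) 1 := by
  obtain rfl : t = moduleTopology ℝ (Module.End ℝ X) := IsModuleTopology.eq_moduleTopology'
  let _ : TopologicalSpace (Module.End ℝ X) := moduleTopology ℝ (Module.End ℝ X)
  rw [connectedComponentIn_eq_image (one_mem G)]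
  rfl

theorem identityComponent_le (G : Subgroup (LinearMap.GeneralLinearGroup ℝ X)) :
    identityComponent G ≤ G := by
  rintro _ ⟨g, -, rfl⟩
  exact g.2

theorem identityComponent_mono {G H : Subgroup (LinearMap.GeneralLinearGroup ℝ X)} (h : G ≤ H) :
    identityComponent G ≤ identityComponent H := by
  intro g hg
  let _ : TopologicalSpace (Module.End ℝ X) := moduleTopology ℝ (Module.End ℝ X)
  have : IsModuleTopology ℝ (Module.End ℝ X) := ⟨rfl⟩
  rw [mem_identityComponent_iff] at hg ⊢
  exact connectedComponentIn_mono _ h hg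

/-- A homomorphism between linear groups which is given by an affine map of endomorphism algebras
maps the identity component into the identity component. -/
theorem map_mem_identityComponent {G : Subgroup (LinearMap.GeneralLinearGroup ℝ X)}
    {H : Subgroup (LinearMap.GeneralLinearGroup ℝ Y)}
    (f : ↥G →* LinearMap.GeneralLinearGroup ℝ Y)
    (A : Module.End ℝ X →ₗ[ℝ] Module.End ℝ Y) (c : Module.End ℝ Y)
    (hf : ∀ g : ↥G, (f g : Module.End ℝ Y) =
      A ((g : LinearMap.GeneralLinearGroup ℝ X) : Module.End ℝ X) + c)
    (hH : ∀ g, f g ∈ H) {g : ↥G}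
    (hg : (g : LinearMap.GeneralLinearGroup ℝ X) ∈ identityComponent G) :
    f g ∈ identityComponent H := by
  let _ : TopologicalSpace (Module.End ℝ X) := moduleTopology ℝ (Module.End ℝ X)
  have : IsModuleTopology ℝ (Module.End ℝ X) := ⟨rfl⟩
  let _ : TopologicalSpace (Module.End ℝ Y) := moduleTopology ℝ (Module.End ℝ Y)
  have : IsModuleTopology ℝ (Module.End ℝ Y) := ⟨rfl⟩
  have : ContinuousAdd (Module.End ℝ Y) := IsModuleTopology.toContinuousAdd ℝ _
  have hA : Continuous fun a => A a + c :=
    (IsModuleTopology.continuous_of_linearMap A).add continuous_const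
  have hc : Continuous f := by
    rw [Units.continuous_iff]
    constructor
    · convert hA.comp (Units.continuous_val.comp (continuous_subtype_val (p := (· ∈ G)))) using 1
      funext g
      exact hf g
    · convert hA.comp (Units.continuous_coe_inv.comp
        (continuous_subtype_val (p := (· ∈ G)))) using 1
      funext g
      -- The unit topology also requires continuity of the inverse, which follows from the same
      -- affine formula at `g⁻¹`.
      rw [← map_inv]
      exact hf g⁻¹
  rw [mem_identityComponent_iff, connectedComponentIn_eq_image (one_mem G)] at hg
  obtain ⟨g', hg', e⟩ := hg
  obtain rfl : g' = g := Subtype.ext e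
  rw [mem_identityComponent_iff]
  refine IsPreconnected.subset_connectedComponentIn
    (isPreconnected_connectedComponent.image f hc.continuousOn)
    ⟨1, mem_connectedComponent, map_one f⟩ ?_ ⟨_, hg', rfl⟩
  rintro _ ⟨g, -, rfl⟩
  exact hH g

/-- A one-parameter group which is polynomial of degree two lies in the identity component. -/
theorem quadratic_mem_identityComponent {G : Subgroup (LinearMap.GeneralLinearGroup ℝ X)}
    (f : Multiplicative ℝ →* LinearMap.GeneralLinearGroup ℝ X) (a b c : Module.End ℝ X)
    (hf : ∀ t : ℝ, (f (Multiplicative.ofAdd t) : Module.End ℝ X) = a + t • b + (t * t) • c)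
    (hG : ∀ t, f t ∈ G) (t : Multiplicative ℝ) : f t ∈ identityComponent G := by
  let _ : TopologicalSpace (Module.End ℝ X) := moduleTopology ℝ (Module.End ℝ X)
  have : IsModuleTopology ℝ (Module.End ℝ X) := ⟨rfl⟩
  have : ContinuousAdd (Module.End ℝ X) := IsModuleTopology.toContinuousAdd ℝ _
  have : ContinuousSMul ℝ (Module.End ℝ X) := IsModuleTopology.toContinuousSMul ℝ _
  have hc : Continuous fun t : ℝ => f (Multiplicative.ofAdd t) := by
    rw [Units.continuous_iff]
    constructor
    · simp only [Function.comp_def, hf]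
      fun_prop
    · simp only [← map_inv, ← ofAdd_neg, hf]
      fun_prop
  rw [mem_identityComponent_iff]
  refine IsPreconnected.subset_connectedComponentIn
    (isPreconnected_univ.image _ hc.continuousOn)
    ⟨0, Set.mem_univ _, map_one f⟩ ?_ ⟨t.toAdd, Set.mem_univ _, rfl⟩
  rintro _ ⟨g, -, rfl⟩
  exact hG _

/-- A linear functional without zeros on `G` which is positive at `1` is positive on the identity
component. -/
theorem pos_of_mem_identityComponent {G : Subgroup (LinearMap.GeneralLinearGroup ℝ X)}
    (φ : Module.End ℝ X →ₗ[ℝ] ℝ) (h1 : 0 < φ 1) (h0 : ∀ g ∈ G, φ (g : Module.End ℝ X) ≠ 0)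
    {g : LinearMap.GeneralLinearGroup ℝ X} (hg : g ∈ identityComponent G) :
    0 < φ (g : Module.End ℝ X) := by
  let _ : TopologicalSpace (Module.End ℝ X) := moduleTopology ℝ (Module.End ℝ X)
  have : IsModuleTopology ℝ (Module.End ℝ X) := ⟨rfl⟩
  have hc : Continuous fun g : LinearMap.GeneralLinearGroup ℝ X => φ (g : Module.End ℝ X) :=
    (IsModuleTopology.continuous_of_linearMap φ).comp Units.continuous_val
  rw [mem_identityComponent_iff] at hg
  by_contra! hn
  -- By the intermediate value theorem, a nonpositive value at `g` would force a zero inside `G`.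
  obtain ⟨y, hy, hy0⟩ := (isPreconnected_connectedComponentIn.image _ hc.continuousOn).Icc_subset
    ⟨g, hg, rfl⟩ ⟨1, mem_connectedComponentIn (one_mem G), rfl⟩ ⟨hn, h1.le⟩
  exact h0 y (connectedComponentIn_subset _ _ hy) hy0

end Topology

/-! ### Real splittings and extension of scalars -/

namespace HyperbolicSplitting

section Real

variable {X Y : Type*} [AddCommGroup X] [Module ℝ X] [FiniteDimensional ℝ X]
  [AddCommGroup Y] [Module ℝ Y]
  {B : LinearMap.BilinForm ℝ X} {C : LinearMap.BilinForm ℝ Y}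
  {z z' : X} {ι : Y →ₗ[ℝ] X} {π : X →ₗ[ℝ] Y}

theorem coeff_pos_of_mem_identityComponent (S : HyperbolicSplitting B C z z' ι π)
    {g : LinearMap.GeneralLinearGroup ℝ X}
    (hg : g ∈ identityComponent (parabolic B (Submodule.span ℝ {z}))) :
    0 < B ((g : Module.End ℝ X) z) z' :=
  pos_of_mem_identityComponent ((B.flip z').comp (LinearMap.applyₗ z)) (by simp [S.zz'])
    (fun _ h => S.coeff_ne_zero_of_mem_parabolic h) hg

theorem reduce_mem_identityComponent [FiniteDimensional ℝ Y]
    (S : HyperbolicSplitting B C z z' ι π)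
    {g : ↥(parabolic B (Submodule.span ℝ {z}))}
    (hg : (g : LinearMap.GeneralLinearGroup ℝ X) ∈
      identityComponent (parabolic B (Submodule.span ℝ {z}))) :
    S.reduce g ∈ identityComponent (orthogonalGroup C) :=
  map_mem_identityComponent S.reduce ((LinearMap.llcomp ℝ Y X Y π).comp (LinearMap.lcomp ℝ X ι)) 0
    (fun g => by rw [add_zero]; rfl) S.reduce_mem_orthogonalGroup hg

theorem lift_mem_identityComponent [FiniteDimensional ℝ Y]
    (S : HyperbolicSplitting B C z z' ι π)
    {h : LinearMap.GeneralLinearGroup ℝ Y} (hh : h ∈ identityComponent (orthogonalGroup C)) :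
    S.lift h ∈ identityComponent (parabolic B (Submodule.span ℝ {z})) :=
  map_mem_identityComponent (S.lift.comp (orthogonalGroup C).subtype)
    ((LinearMap.llcomp ℝ X Y X ι).comp (LinearMap.lcomp ℝ Y π))
    ((B.flip z').smulRight z + (B.flip z).smulRight z')
    (fun _ => rfl) (fun g => S.lift_mem_parabolic g.2)
    (g := ⟨h, identityComponent_le _ hh⟩) hh

theorem siegel_mem_identityComponent (S : HyperbolicSplitting B C z z' ι π)
    (y : Multiplicative Y) :
    S.siegel y ∈ identityComponent (parabolic B (Submodule.span ℝ {z})) := by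
  -- The one-parameter group `t ↦ siegel (t y)`, evaluated at `t = 1`.
  have h := quadratic_mem_identityComponent
    (S.siegel.comp (AddMonoidHom.toMultiplicative (LinearMap.toSpanSingleton ℝ Y y.toAdd)))
    1 ((B.flip z).smulRight (ι y.toAdd) - (B.flip (ι y.toAdd)).smulRight z)
    (-((2⁻¹ * C y.toAdd y.toAdd) • (B.flip z).smulRight z))
    (fun t => by
      ext x
      simp [siegelEnd_apply]
      module)
    (fun t => S.siegel_mem_parabolic _) (Multiplicative.ofAdd 1)
  simpa using h

end Real

section BaseChange

variable {X Y : Type*} [AddCommGroup X] [Module ℚ X] [AddCommGroup Y] [Module ℚ Y]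
  {B : LinearMap.BilinForm ℚ X} {C : LinearMap.BilinForm ℚ Y}
  {z z' : X} {ι : Y →ₗ[ℚ] X} {π : X →ₗ[ℚ] Y}

/-- Every clause is an identity of linear or bilinear maps, hence can be checked on vectors `1 ⊗ x`.
-/
theorem baseChange (S : HyperbolicSplitting B C z z' ι π) :
    HyperbolicSplitting (B.baseChange ℝ) (C.baseChange ℝ) ((1 : ℝ) ⊗ₜ[ℚ] z) ((1 : ℝ) ⊗ₜ[ℚ] z')
      (ι.baseChange ℝ) (π.baseChange ℝ) where
  symm := ⟨(LinearMap.BilinForm.IsSymm.baseChange ℝ (B₂ := B) ⟨S.symm.eq⟩).eq⟩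
  zz := by simp [S.zz]
  zz' := by simp [S.zz']
  z'z' := by simp [S.z'z']
  ιz y := by
    have : ((B.baseChange ℝ).flip ((1 : ℝ) ⊗ₜ[ℚ] z)).comp (ι.baseChange ℝ) = 0 := by
      ext y; simp [S.ιz]
    exact congr($this y)
  ιz' y := by
    have : ((B.baseChange ℝ).flip ((1 : ℝ) ⊗ₜ[ℚ] z')).comp (ι.baseChange ℝ) = 0 := by
      ext y; simp [S.ιz']
    exact congr($this y)
  ιι x y := by
    have : (B.baseChange ℝ).compl₁₂ (ι.baseChange ℝ) (ι.baseChange ℝ) = C.baseChange ℝ := by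
      ext x y; simp [S.ιι]
    exact congr($this x y)
  πz := by simp [S.πz]
  πz' := by simp [S.πz']
  πι y := by
    have : (π.baseChange ℝ).comp (ι.baseChange ℝ) = LinearMap.id := by
      ext y; simp [S.πι]
    exact congr($this y)
  decomp x := by
    have : LinearMap.id = (ι.baseChange ℝ).comp (π.baseChange ℝ) +
        ((B.baseChange ℝ).flip ((1 : ℝ) ⊗ₜ[ℚ] z')).smulRight ((1 : ℝ) ⊗ₜ[ℚ] z) +
        ((B.baseChange ℝ).flip ((1 : ℝ) ⊗ₜ[ℚ] z)).smulRight ((1 : ℝ) ⊗ₜ[ℚ] z') := by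
      ext x
      have e : (1 : ℝ) ⊗ₜ[ℚ] x = (1 : ℝ) ⊗ₜ[ℚ] (ι (π x) + B x z' • z + B x z • z') := by
        rw [← S.decomp x]
      simpa [TensorProduct.tmul_add, TensorProduct.smul_tmul'] using e
    exact congr($this x)

theorem realExtension_tmul (g : LinearMap.GeneralLinearGroup ℚ X) (a : ℝ) (x : X) :
    (realExtension X g : Module.End ℝ (ℝ ⊗[ℚ] X)) (a ⊗ₜ[ℚ] x) =
      a ⊗ₜ[ℚ] ((g : Module.End ℚ X) x) := rfl

theorem realExtension_lift (S : HyperbolicSplitting B C z z' ι π)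
    (h : LinearMap.GeneralLinearGroup ℚ Y) :
    realExtension X (S.lift h) = S.baseChange.lift (realExtension Y h) := by
  refine Units.ext ?_
  ext x
  simp [realExtension_tmul, liftEnd_apply, TensorProduct.tmul_add, TensorProduct.smul_tmul']

theorem realExtension_siegel (S : HyperbolicSplitting B C z z' ι π) (y : Y) :
    realExtension X (S.siegel (Multiplicative.ofAdd y)) =
      S.baseChange.siegel (Multiplicative.ofAdd ((1 : ℝ) ⊗ₜ[ℚ] y)) := by
  refine Units.ext ?_
  ext x
  simp [realExtension_tmul, siegelEnd_apply, TensorProduct.tmul_add, TensorProduct.smul_tmul',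
    TensorProduct.tmul_sub, Rat.smul_def]

theorem span_baseChange (z : X) : (Submodule.span ℚ {z}).baseChange ℝ =
    Submodule.span ℝ {(1 : ℝ) ⊗ₜ[ℚ] z} := by
  rw [Submodule.baseChange_span, Set.image_singleton]; rfl

theorem realExtension_reduce (S : HyperbolicSplitting B C z z' ι π)
    (g : ↥(parabolic B (Submodule.span ℚ {z})))
    (hg : realExtension X g ∈
      parabolic (B.baseChange ℝ) (Submodule.span ℝ {(1 : ℝ) ⊗ₜ[ℚ] z})) :
    realExtension Y (S.reduce g) = S.baseChange.reduce ⟨_, hg⟩ := by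
  refine Units.ext ?_
  ext x
  simp [realExtension_tmul]

end BaseChange

end HyperbolicSplitting

/-! ### Dual lattices and primitive vectors -/

section

variable {V : Type*} [AddCommGroup V] [Module ℚ V] {B : LinearMap.BilinForm ℚ V}
  {L : Submodule ℤ V}

theorem mem_dualSubmodule_iff {x : V} :
    x ∈ B.dualSubmodule L ↔ ∀ y ∈ L, ∃ n : ℤ, B x y = n := by
  rw [LinearMap.BilinForm.mem_dualSubmodule]
  refine forall₂_congr fun y _ => ?_
  rw [Submodule.mem_one]
  exact exists_congr fun n => by simp [eq_comm]

/-- Polarization: `2 B x y` is a combination of even norms. -/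
theorem le_dualSubmodule_of_even (hB : B.IsSymm) (h : ∀ x ∈ L, ∃ n : ℤ, B x x = 2 * (n : ℚ)) :
    L ≤ B.dualSubmodule L := by
  intro x hx
  rw [mem_dualSubmodule_iff]
  intro y hy
  obtain ⟨a, ha⟩ := h x hx
  obtain ⟨b, hb⟩ := h y hy
  obtain ⟨c, hc⟩ := h (x + y) (L.add_mem hx hy)
  refine ⟨c - a - b, ?_⟩
  simp only [map_add, LinearMap.add_apply, hB.eq y x] at hc
  push_cast
  linarith

theorem setwiseStabilizer_apply_mem {g : LinearMap.GeneralLinearGroup ℚ V}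
    (hg : g ∈ setwiseStabilizer ℚ L.toAddSubgroup) {x : V} (hx : x ∈ L) :
    (g : Module.End ℚ V) x ∈ L := by
  have e : (fun x => (g : Module.End ℚ V) x) '' (L : Set V) = L := hg
  have : (g : Module.End ℚ V) x ∈ (L : Set V) := by
    rw [← e]
    exact ⟨x, hx, rfl⟩
  exact this

/-- As `L` lies in its dual, moving dual vectors only by elements of `L`, for both `g` and `g⁻¹`,
already forces `g L = L`. -/
theorem mem_discriminantKernel_of (hL : L ≤ B.dualSubmodule L)
    {g : LinearMap.GeneralLinearGroup ℚ V} (hg : g ∈ orthogonalGroup B)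
    (h : ∀ ν ∈ B.dualSubmodule L, (g : Module.End ℚ V) ν - ν ∈ L)
    (h' : ∀ ν ∈ B.dualSubmodule L,
      ((g⁻¹ : LinearMap.GeneralLinearGroup ℚ V) : Module.End ℚ V) ν - ν ∈ L) :
    g ∈ discriminantKernel B L := by
  refine ⟨⟨hg, ?_⟩, h⟩
  change (fun x => (g : Module.End ℚ V) x) '' (L : Set V) = L
  apply Set.Subset.antisymm
  · rintro _ ⟨x, hx, rfl⟩
    simpa using L.add_mem (h x (hL hx)) hx
  · intro x hx
    refine ⟨((g⁻¹ : LinearMap.GeneralLinearGroup ℚ V) : Module.End ℚ V) x,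
      by simpa using L.add_mem (h' x (hL hx)) hx, ?_⟩
    change ((g : Module.End ℚ V) *
      ((g⁻¹ : LinearMap.GeneralLinearGroup ℚ V) : Module.End ℚ V)) x = x
    rw [Units.mul_inv, Module.End.one_apply]

/-- A primitive vector of a lattice pairs to `1` with some vector of the dual lattice. -/
theorem exists_dual_pairing_eq_one (hB : B.IsSymm) (hnd : B.Nondegenerate) (hfg : L.FG)
    (hspan : Submodule.span ℚ (L : Set V) = ⊤) {z : V} (hz : IsPrimitive L z) :
    ∃ ν ∈ B.dualSubmodule L, B z ν = 1 := by
  classical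
  have : Submodule.IsLattice ℚ L := ⟨hfg, hspan⟩
  have := Submodule.IsLattice.free ℚ L
  have : Module.Finite ℤ L := Module.Finite.iff_fg.2 hfg
  let b := Module.Free.chooseBasis ℤ L
  let b' := b.extendOfIsLattice ℚ
  let zL : L := ⟨z, hz.1⟩
  -- The ideal of coordinates of `z`. Its generator divides `z` in `L`, so primitivity makes it a
  -- unit.
  let J : Ideal ℤ := Ideal.span (Set.range fun i => b.repr zL i)
  obtain ⟨d, hd⟩ := (inferInstance : J.IsPrincipal).principal
  have hdvd : ∀ i, ∃ c, b.repr zL i = d * c := fun i => by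
    have : b.repr zL i ∈ J := Ideal.subset_span ⟨i, rfl⟩
    rw [hd] at this
    exact Ideal.mem_span_singleton.1 this
  choose c hc using hdvd
  have hzd : z = d • ((∑ i, c i • b i : L) : V) := by
    have : zL = d • ∑ i, c i • b i := by
      conv_lhs => rw [← b.sum_repr zL]
      rw [Finset.smul_sum]
      exact Finset.sum_congr rfl fun i _ => by rw [hc, mul_smul]
    exact congr(($this : V))
  have hu := hz.2 _ (∑ i, c i • b i : L).2 d hzd
  have h1 : (1 : ℤ) ∈ Ideal.span (Set.range fun i => b.repr zL i) := by
    change 1 ∈ J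
    rw [hd]
    exact Ideal.mem_span_singleton.2 hu.dvd
  obtain ⟨a, ha⟩ := (Ideal.mem_span_range_iff_exists_fun).1 h1
  -- The witness combines the dual basis with the Bézout coefficients `a i`.
  have key : ∀ x : L, B (∑ i, a i • B.dualBasis hnd b' i) x = (∑ i, a i * b.repr x i : ℤ) := by
    intro x
    have hx : (x : V) = ∑ i, b.repr x i • b' i := by
      simp only [b', Module.Basis.extendOfIsLattice_apply]
      conv_lhs => rw [← b.sum_repr x]
      simp only [Submodule.coe_sum, Submodule.coe_smul]
    rw [hx]
    simp only [map_sum, LinearMap.sum_apply, map_zsmul, LinearMap.smul_apply,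
      LinearMap.BilinForm.apply_dualBasis_left]
    simp [mul_comm]
  refine ⟨∑ i, a i • B.dualBasis hnd b' i, ?_, ?_⟩
  · rw [mem_dualSubmodule_iff]
    exact fun y hy => ⟨_, key ⟨y, hy⟩⟩
  · rw [hB.eq, ← Int.cast_one, ← ha]
    exact key zL

end

/-- A hyperbolic pair `z, z'` induces a splitting with complement `U^⊥ / U`, where `U` is the line
spanned by `z`. -/
theorem exists_hyperbolicSplitting {F X : Type*} [Field F] [AddCommGroup X] [Module F X]
    {B : LinearMap.BilinForm F X} (hB : B.IsSymm) {z z' : X} (hzz : B z z = 0)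
    (hzz' : B z z' = 1) (hz'z' : B z' z' = 0) (U : Submodule F X)
    (hU : U = Submodule.span F {z}) :
    ∃ (ι : perpQuotient B U →ₗ[F] X) (π : X →ₗ[F] perpQuotient B U),
      HyperbolicSplitting B (perpQuotientForm B hB U) z z' ι π ∧
        ∀ v : ↥(B.orthogonal U), π (v : X) = Submodule.Quotient.mk v := by
  have hz'z : B z' z = 1 := by rw [hB.eq, hzz']
  have hzU : z ∈ U := hU ▸ Submodule.mem_span_singleton_self z
  have hmem : ∀ v, v ∈ B.orthogonal U ↔ B v z = 0 := by
    intro v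
    rw [LinearMap.BilinForm.mem_orthogonal_iff]
    constructor
    · intro h
      rw [hB.eq]
      exact h z hzU
    · intro h u hu
      rw [hU] at hu
      obtain ⟨c, rfl⟩ := Submodule.mem_span_singleton.1 hu
      change B (c • z) v = 0
      rw [map_smul, LinearMap.smul_apply, hB.eq, h, smul_zero]
  let p : X →ₗ[F] ↥(B.orthogonal U) := LinearMap.codRestrict _
    (LinearMap.id - (B.flip z').smulRight z - (B.flip z).smulRight z') (fun v => by
      rw [hmem]
      simp [hzz, hz'z])
  have hp : ∀ v, (p v : X) = v - B v z' • z - B v z • z' := fun v => rfl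
  -- A class in `U^⊥ / U` goes to its unique representative orthogonal to `z'`.
  let ι : perpQuotient B U →ₗ[F] X := (U.submoduleOf (B.orthogonal U)).liftQ
    ((LinearMap.id - (B.flip z').smulRight z).comp (B.orthogonal U).subtype) (by
      intro u hu
      have hu' : (u : X) ∈ Submodule.span F {z} := hU.le hu
      obtain ⟨c, hc⟩ := Submodule.mem_span_singleton.1 hu'
      simp [← hc, hzz'])
  have hι : ∀ v : ↥(B.orthogonal U), ι (Submodule.Quotient.mk v) = v - B v z' • z :=
    fun v => rfl
  let π : X →ₗ[F] perpQuotient B U := (U.submoduleOf (B.orthogonal U)).mkQ.comp p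
  have hmk : ∀ v : ↥(B.orthogonal U), π (v : X) = Submodule.Quotient.mk v := by
    intro v
    refine (Submodule.Quotient.eq _).2 ?_
    change (p v : X) - v ∈ U
    rw [hp, (hmem v).1 v.2]
    simpa using U.smul_mem _ hzU
  refine ⟨ι, π, ⟨⟨hB.eq⟩, hzz, hzz', hz'z', ?_, ?_, ?_, ?_, ?_, ?_, ?_⟩, hmk⟩
  · intro y
    obtain ⟨v, rfl⟩ := Submodule.Quotient.mk_surjective _ y
    simp [hι, (hmem v).1 v.2, hzz]
  · intro y
    obtain ⟨v, rfl⟩ := Submodule.Quotient.mk_surjective _ y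
    simp [hι, hzz']
  · intro x y
    obtain ⟨v, rfl⟩ := Submodule.Quotient.mk_surjective _ x
    obtain ⟨w, rfl⟩ := Submodule.Quotient.mk_surjective _ y
    have hw : B z w = 0 := by rw [hB.eq, (hmem w).1 w.2]
    simp [hι, (hmem v).1 v.2, hw, hzz]
  · have := hmk ⟨z, (hmem z).2 hzz⟩
    rw [this]
    exact (Submodule.Quotient.mk_eq_zero _).2 hzU
  · have : p z' = 0 := Subtype.ext (by simp [hp, hz'z', hz'z])
    simp [π, this]
  · intro y
    obtain ⟨v, rfl⟩ := Submodule.Quotient.mk_surjective _ y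
    have : π z = 0 := by
      rw [hmk ⟨z, (hmem z).2 hzz⟩]
      exact (Submodule.Quotient.mk_eq_zero _).2 hzU
    rw [hι, map_sub, map_smul, this, hmk]
    simp
  · intro x
    change x = ι (Submodule.Quotient.mk (p x)) + _ + _
    rw [hι]
    simp [hp, hz'z', hzz']
    abel

/-! ### Splittings adapted to a lattice -/

/-- A hyperbolic splitting of a rational quadratic space adapted to an even lattice `L` containing
`z`, together with the induced lattice `M` in the complement. -/
structure LatticeSplitting {X Y : Type*} [AddCommGroup X] [Module ℚ X]
    [AddCommGroup Y] [Module ℚ Y] (B : LinearMap.BilinForm ℚ X) (C : LinearMap.BilinForm ℚ Y)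
    (z z' : X) (ι : Y →ₗ[ℚ] X) (π : X →ₗ[ℚ] Y) (L : Submodule ℤ X) (M : Submodule ℤ Y) : Prop
    extends HyperbolicSplitting B C z z' ι π where
  even : ∀ x ∈ L, ∃ n : ℤ, B x x = 2 * (n : ℚ)
  z_mem : z ∈ L
  -- The correction making `z'` isotropic may take it out of the dual lattice. The ambiguity `q • z`
  -- is invisible on `z^⊥` and to maps fixing `z`.
  exists_dual : ∃ q : ℚ, z' + q • z ∈ B.dualSubmodule L
  mem_iff : ∀ y, y ∈ M ↔ ι y ∈ L

namespace LatticeSplitting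

variable {X Y : Type*} [AddCommGroup X] [Module ℚ X] [AddCommGroup Y] [Module ℚ Y]
  {B : LinearMap.BilinForm ℚ X} {C : LinearMap.BilinForm ℚ Y}
  {z z' : X} {ι : Y →ₗ[ℚ] X} {π : X →ₗ[ℚ] Y} {L : Submodule ℤ X} {M : Submodule ℤ Y}

theorem le_dual (T : LatticeSplitting B C z z' ι π L M) : L ≤ B.dualSubmodule L :=
  le_dualSubmodule_of_even ⟨T.comm⟩ T.even

theorem le_dual_complement (T : LatticeSplitting B C z z' ι π L M) :
    M ≤ C.dualSubmodule M := by
  intro x hx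
  rw [mem_dualSubmodule_iff]
  intro y hy
  rw [← T.ιι]
  exact mem_dualSubmodule_iff.1 (T.le_dual ((T.mem_iff x).1 hx)) _ ((T.mem_iff y).1 hy)

theorem smul_z_mem (T : LatticeSplitting B C z z' ι π L M) {q : ℚ} (hq : ∃ n : ℤ, q = n) :
    q • z ∈ L := by
  obtain ⟨n, rfl⟩ := hq
  rw [Int.cast_smul_eq_zsmul]
  exact L.smul_mem n T.z_mem

theorem pairing_int (T : LatticeSplitting B C z z' ι π L M) {x : X} (hx : x ∈ L)
    (hxz : B x z = 0) : ∃ n : ℤ, B x z' = n := by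
  obtain ⟨q, hq⟩ := T.exists_dual
  obtain ⟨n, hn⟩ := mem_dualSubmodule_iff.1 hq x hx
  refine ⟨n, ?_⟩
  rw [T.comm, ← hn]
  simp [T.comm z x, hxz]

theorem proj_mem (T : LatticeSplitting B C z z' ι π L M) {x : X} (hx : x ∈ L)
    (hxz : B x z = 0) : π x ∈ M := by
  rw [T.mem_iff, T.ι_proj_of_perp hxz]
  exact L.sub_mem hx (T.smul_z_mem (T.pairing_int hx hxz))

/-- Evenness makes `C y y / 2` an integer, so all coefficients of the displacement of a dual vector
are integral. -/
theorem siegel_sub_mem (T : LatticeSplitting B C z z' ι π L M) {y : Y} (hy : y ∈ M)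
    {ν : X} (hν : ν ∈ B.dualSubmodule L) :
    T.siegelEnd y ν - ν ∈ L := by
  rw [mem_dualSubmodule_iff] at hν
  have hy' := (T.mem_iff y).1 hy
  obtain ⟨a, ha⟩ := hν z T.z_mem
  obtain ⟨b, hb⟩ := hν _ hy'
  obtain ⟨c, hc⟩ := T.even _ hy'
  rw [T.ιι] at hc
  have e : T.siegelEnd y ν - ν = a • ι y - b • z - (c * a) • z := by
    rw [HyperbolicSplitting.siegelEnd_apply, ha, hb, hc, Int.cast_smul_eq_zsmul,
      Int.cast_smul_eq_zsmul, Int.cast_smul_eq_zsmul, inv_mul_cancel_left₀ two_ne_zero,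
      Int.cast_smul_eq_zsmul, mul_smul]
    abel
  rw [e]
  exact L.sub_mem (L.sub_mem (L.smul_mem _ hy') (L.smul_mem _ T.z_mem)) (L.smul_mem _ T.z_mem)

theorem siegel_mem_discriminantKernel (T : LatticeSplitting B C z z' ι π L M) {y : Y}
    (hy : y ∈ M) : T.siegel (Multiplicative.ofAdd y) ∈ discriminantKernel B L := by
  refine mem_discriminantKernel_of T.le_dual (T.siegel_mem_orthogonalGroup _)
    (fun ν hν => T.siegel_sub_mem hy hν) (fun ν hν => ?_)
  rw [← map_inv, ← ofAdd_neg]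
  exact T.siegel_sub_mem (M.neg_mem hy) hν

/-- The displacement is the image under `ι` of the displacement of `π ν`, which is a dual vector of
`M` by adjunction. -/
theorem lift_sub_mem (T : LatticeSplitting B C z z' ι π L M)
    {h : LinearMap.GeneralLinearGroup ℚ Y} (hh : h ∈ discriminantKernel C M)
    {ν : X} (hν : ν ∈ B.dualSubmodule L) :
    (T.lift h : Module.End ℚ X) ν - ν ∈ L := by
  have e : (T.lift h : Module.End ℚ X) ν - ν = ι ((h : Module.End ℚ Y) (π ν) - π ν) := by
    rw [HyperbolicSplitting.coe_lift, HyperbolicSplitting.liftEnd_apply, map_sub]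
    conv_lhs => rhs; rw [T.decomp ν]
    abel
  rw [e, ← T.mem_iff]
  refine hh.2 _ ?_
  rw [mem_dualSubmodule_iff] at hν ⊢
  intro y hy
  rw [T.form_proj]
  exact hν _ ((T.mem_iff y).1 hy)

theorem lift_mem_discriminantKernel (T : LatticeSplitting B C z z' ι π L M)
    {h : LinearMap.GeneralLinearGroup ℚ Y} (hh : h ∈ discriminantKernel C M) :
    T.lift h ∈ discriminantKernel B L := by
  refine mem_discriminantKernel_of T.le_dual (T.lift_mem_orthogonalGroup hh.1.1)
    (fun ν hν => T.lift_sub_mem hh hν) (fun ν hν => ?_)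
  rw [← map_inv]
  exact T.lift_sub_mem (inv_mem hh) hν

/-- Every vector of the dual lattice of `M` lifts to a vector of the dual lattice of `L` which is
orthogonal to `z`. -/
theorem exists_dual_lift (T : LatticeSplitting B C z z' ι π L M) {ν : Y}
    (hν : ν ∈ C.dualSubmodule M) : ∃ c : ℚ, ι ν + c • z ∈ B.dualSubmodule L := by
  rw [mem_dualSubmodule_iff] at hν
  -- The values `B x z` on `L` form an ideal `(N)`, and `l` attains `N`. So `L` is spanned by `L ∩
  -- z^⊥` and `l`. On the former `ι ν` is integral, and the multiple of `z` corrects the pairing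
  -- with `l`.
  let J : Ideal ℤ :=
    { carrier := {n | ∃ x ∈ L, B x z = n}
      add_mem' := by
        rintro a b ⟨x, hx, hxa⟩ ⟨y, hy, hyb⟩
        exact ⟨x + y, L.add_mem hx hy, by simp [hxa, hyb]⟩
      zero_mem' := ⟨0, L.zero_mem, by simp⟩
      smul_mem' := by
        rintro c a ⟨x, hx, hxa⟩
        exact ⟨c • x, L.smul_mem c hx, by simp [hxa]⟩ }
  obtain ⟨N, hN⟩ := (inferInstance : J.IsPrincipal).principal
  obtain ⟨l, hl, hlN⟩ : N ∈ J := hN ▸ Ideal.mem_span_singleton_self N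
  have h0 : ∀ x ∈ L, B x z = 0 → ∃ n : ℤ, B (ι ν) x = n := by
    intro x hx hxz
    obtain ⟨n, hn⟩ := hν _ (T.proj_mem hx hxz)
    refine ⟨n, ?_⟩
    rw [← hn, T.form_comm, T.form_proj, T.comm]
  have hl' : ∃ n : ℤ, B (ι ν + (-B (ι ν) l / N) • z) l = n := by
    by_cases hN0 : (N : ℚ) = 0
    -- If `N = 0`, division by zero makes the correction vanish, and `l` itself is orthogonal to
    -- `z`.
    · obtain ⟨n, hn⟩ := h0 l hl (by rw [hlN, hN0])
      exact ⟨n, by simp [hN0, hn]⟩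
    · refine ⟨0, ?_⟩
      simp only [map_add, map_smul, LinearMap.add_apply, LinearMap.smul_apply, smul_eq_mul,
        T.comm z l, hlN]
      field_simp
      simp
  refine ⟨-B (ι ν) l / N, ?_⟩
  rw [mem_dualSubmodule_iff]
  intro x hx
  obtain ⟨m, hm⟩ := mem_dualSubmodule_iff.1 (T.le_dual hx) z T.z_mem
  have hmJ : m ∈ J := ⟨x, hx, hm⟩
  rw [hN] at hmJ
  obtain ⟨k, rfl⟩ := Ideal.mem_span_singleton.1 hmJ
  have hxk : B (x - k • l) z = 0 := by
    simp [hm, hlN, mul_comm]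
  obtain ⟨n, hn⟩ := h0 (x - k • l) (L.sub_mem hx (L.smul_mem k hl)) hxk
  obtain ⟨n', hn'⟩ := hl'
  refine ⟨n + k * n', ?_⟩
  have e : x = (x - k • l) + k • l := by abel
  rw [e, map_add, map_zsmul, hn', map_add, LinearMap.add_apply, hn, map_smul,
    LinearMap.smul_apply, T.comm z, hxk]
  simp

/-- Lift `ν` to a dual vector `ι ν + c • z` of `L`. Since `g` fixes `z`, the unknown `c` cancels in
its displacement, which lies in `L ∩ z^⊥` and projects into `M`. -/
theorem reduce_sub_mem (T : LatticeSplitting B C z z' ι π L M)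
    (g : ↥(parabolic B (Submodule.span ℚ {z})))
    (hz : ((g : LinearMap.GeneralLinearGroup ℚ X) : Module.End ℚ X) z = z)
    (hg : (g : LinearMap.GeneralLinearGroup ℚ X) ∈ discriminantKernel B L)
    {ν : Y} (hν : ν ∈ C.dualSubmodule M) :
    (T.reduce g : Module.End ℚ Y) ν - ν ∈ M := by
  obtain ⟨c, hc⟩ := T.exists_dual_lift hν
  have h1 := hg.2 _ hc
  rw [map_add, map_smul, hz, add_sub_add_right_eq_sub] at h1
  have h2 := T.proj_mem h1 (by
    rw [map_sub, LinearMap.sub_apply, T.perp_of_mem_parabolic g.2 (T.ιz ν), T.ιz, sub_zero])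
  rwa [map_sub, T.πι] at h2

theorem inv_apply_z {g : LinearMap.GeneralLinearGroup ℚ X}
    (hz : (g : Module.End ℚ X) z = z) :
    ((g⁻¹ : LinearMap.GeneralLinearGroup ℚ X) : Module.End ℚ X) z = z := by
  conv_lhs => rw [← hz]
  rw [← Module.End.mul_apply, Units.inv_mul, Module.End.one_apply]

theorem reduce_mem_discriminantKernel (T : LatticeSplitting B C z z' ι π L M)
    (g : ↥(parabolic B (Submodule.span ℚ {z})))
    (hz : ((g : LinearMap.GeneralLinearGroup ℚ X) : Module.End ℚ X) z = z)
    (hg : (g : LinearMap.GeneralLinearGroup ℚ X) ∈ discriminantKernel B L) :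
    T.reduce g ∈ discriminantKernel C M := by
  refine mem_discriminantKernel_of T.le_dual_complement (T.reduce_mem_orthogonalGroup g)
    (fun ν hν => T.reduce_sub_mem g hz hg hν) (fun ν hν => ?_)
  rw [← map_inv]
  exact T.reduce_sub_mem g⁻¹ (inv_apply_z hz) (inv_mem hg) hν

/-- Apply triviality on the discriminant group to `z' + q • z`. The multiple of `z` cancels, leaving
`g z' - z' ∈ L ∩ z^⊥`. -/
theorem proj_apply_z'_mem (T : LatticeSplitting B C z z' ι π L M)
    {g : LinearMap.GeneralLinearGroup ℚ X} (hz : (g : Module.End ℚ X) z = z)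
    (hg : g ∈ discriminantKernel B L) : π ((g : Module.End ℚ X) z') ∈ M := by
  obtain ⟨q, hq⟩ := T.exists_dual
  have h1 := hg.2 _ hq
  rw [map_add, map_smul, hz, add_sub_add_right_eq_sub] at h1
  have e := hg.1.1 z' z
  rw [hz] at e
  have h2 := T.proj_mem h1 (by rw [map_sub, LinearMap.sub_apply, e, sub_self])
  rwa [map_sub, T.πz', sub_zero] at h2

variable [FiniteDimensional ℚ X]

/-- Elements of `Γ_L` in the identity component of the stabilizer of `ℝz` fix `z`. -/
theorem apply_z_eq (T : LatticeSplitting B C z z' ι π L M)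
    {g : LinearMap.GeneralLinearGroup ℚ X} (hg : g ∈ discriminantKernel B L)
    (hg' : realExtension X g ∈ identityComponent
      (parabolic (B.baseChange ℝ) (Submodule.span ℝ {(1 : ℝ) ⊗ₜ[ℚ] z}))) :
    (g : Module.End ℚ X) z = z := by
  have hpos := T.baseChange.coeff_pos_of_mem_identityComponent hg'
  have heq := T.baseChange.apply_eq_smul_of_mem_parabolic (identityComponent_le _ hg')
  simp only [HyperbolicSplitting.realExtension_tmul, LinearMap.BilinForm.baseChange_tmul, mul_one,
    Rat.smul_one_eq_cast, Rat.cast_pos] at hpos heq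
  rw [Rat.cast_smul_eq_qsmul, ← TensorProduct.tmul_smul] at heq
  -- The real eigenvalue equation descends to ℚ.
  have hq := Module.FaithfullyFlat.tensorProduct_mk_injective (A := ℚ) (B := ℝ) X heq
  -- Pairing with the dual vector `z' + r • z` recovers `q`, so rational multiples of `z` in `L` are
  -- integral.
  have hint : ∀ {q : ℚ}, q • z ∈ L → ∃ n : ℤ, q = n := by
    intro q hqL
    obtain ⟨r, hr⟩ := T.exists_dual
    obtain ⟨n, hn⟩ := mem_dualSubmodule_iff.1 hr _ hqL
    refine ⟨n, ?_⟩
    simpa [T.z'z, T.zz] using hn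
  set q := B ((g : Module.End ℚ X) z) z'
  obtain ⟨n, hn⟩ := hint (hq ▸ setwiseStabilizer_apply_mem hg.1.2 T.z_mem)
  have hinv : ((g⁻¹ : LinearMap.GeneralLinearGroup ℚ X) : Module.End ℚ X) z = q⁻¹ • z := by
    rw [eq_inv_smul_iff₀ hpos.ne', ← map_smul, ← hq, ← Module.End.mul_apply, Units.inv_mul,
      Module.End.one_apply]
  obtain ⟨m, hm⟩ := hint (hinv ▸ setwiseStabilizer_apply_mem (inv_mem hg.1).2 T.z_mem)
  have hnm : n * m = 1 := by
    have : (n : ℚ) * m = 1 := by rw [← hn, ← hm, mul_inv_cancel₀ hpos.ne']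
    exact_mod_cast this
  have hn0 : 0 < n := by
    rw [hn] at hpos
    exact_mod_cast hpos
  have hn1 : n = 1 := by
    rcases Int.eq_one_or_neg_one_of_mul_eq_one hnm with h | h <;> lia
  rw [hq, hn, hn1, Int.cast_one, one_smul]

/-- The `SO⁺` condition is redundant: a stabilizer's identity component lies in that of the full
orthogonal group. -/
theorem mem_gammaParabolic_iff {I : Submodule ℤ X}
    (hI : Submodule.span ℚ (I : Set X) = Submodule.span ℚ {z})
    {g : LinearMap.GeneralLinearGroup ℚ X} :
    g ∈ GammaParabolic B L I ↔ g ∈ discriminantKernel B L ∧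
      realExtension X g ∈ identityComponent
        (parabolic (B.baseChange ℝ) (Submodule.span ℝ {(1 : ℝ) ⊗ₜ[ℚ] z})) := by
  rw [GammaParabolic, hI, HyperbolicSplitting.span_baseChange]
  exact ⟨fun h => ⟨h.1.1, h.2⟩, fun h => ⟨⟨h.1, identityComponent_mono inf_le_left h.2⟩, h.2⟩⟩

theorem nonempty_mulEquiv [FiniteDimensional ℚ Y]
    (T : LatticeSplitting B C z z' ι π L M) {I : Submodule ℤ X}
    (hI : Submodule.span ℚ (I : Set X) = Submodule.span ℚ {z}) :
    Nonempty (↥(GammaParabolic B L I) ≃*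
      Multiplicative ↥M ⋊[latticeAction C M] ↥(Gamma C M)) := by
  let fn : Multiplicative ↥M →* LinearMap.GeneralLinearGroup ℚ X :=
    T.siegel.comp (AddMonoidHom.toMultiplicative M.subtype.toAddMonoidHom)
  let fg : ↥(Gamma C M) →* LinearMap.GeneralLinearGroup ℚ X := T.lift.comp (Gamma C M).subtype
  let f := SemidirectProduct.lift (φ := latticeAction C M) fn fg (fun h => MonoidHom.ext fun y =>
    (T.lift_mul_siegel_mul_inv h.2.1.1.1 (y.toAdd : Y)).symm)
  have hf : ∀ a, f a = T.siegel (Multiplicative.ofAdd (a.left.toAdd : Y)) * T.lift a.right :=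
    fun a => rfl
  have hinj : Function.Injective f := by
    rw [injective_iff_map_eq_one]
    intro a ha
    obtain ⟨h1, h2⟩ := T.siegel_mul_lift_injective ((hf a).symm.trans ha)
    exact SemidirectProduct.ext (Subtype.ext h1) (Subtype.ext h2)
  have hrange : f.range = GammaParabolic B L I := by
    ext g
    rw [mem_gammaParabolic_iff hI]
    constructor
    · rintro ⟨a, rfl⟩
      rw [hf]
      refine ⟨mul_mem (T.siegel_mem_discriminantKernel a.left.toAdd.2)
        (T.lift_mem_discriminantKernel a.right.2.1), ?_⟩
      rw [map_mul, T.realExtension_siegel, T.realExtension_lift]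
      exact mul_mem (T.baseChange.siegel_mem_identityComponent _)
        (T.baseChange.lift_mem_identityComponent a.right.2.2)
    · rintro ⟨h1, h2⟩
      have hz := T.apply_z_eq h1 h2
      -- Surjectivity: the preimage has transvection part `π (g z')` and linear part the reduction
      -- of `g`.
      let g' : ↥(parabolic B (Submodule.span ℚ {z})) :=
        ⟨g, HyperbolicSplitting.mem_parabolic_of_fix h1.1.1 hz⟩
      have hr : T.reduce g' ∈ Gamma C M := by
        refine ⟨T.reduce_mem_discriminantKernel g' hz h1, ?_⟩
        change realExtension Y (T.reduce g') ∈
          identityComponent (orthogonalGroup (C.baseChange ℝ))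
        rw [T.realExtension_reduce g' (identityComponent_le _ h2)]
        exact T.baseChange.reduce_mem_identityComponent h2
      exact ⟨⟨Multiplicative.ofAdd ⟨_, T.proj_apply_z'_mem hz h1⟩, ⟨_, hr⟩⟩,
        (T.eq_siegel_mul_lift g' hz).symm⟩
  exact ⟨((MonoidHom.ofInjective hinj).trans (MulEquiv.subgroupCongr hrange)).symm⟩

end LatticeSplitting

end EvenLattice

/-! ### The splitting attached to a primitive isotropic vector -/

theorem corollary3p6 {V : Type*} [AddCommGroup V] [Module ℚ V] [FiniteDimensional ℚ V]
    (B : LinearMap.BilinForm ℚ V) (hB : B.IsSymm) (hnd : B.Nondegenerate)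
    (L : Submodule ℤ V) (hL : EvenLattice.IsEvenLattice B L)
    (z : V) (hz : EvenLattice.IsPrimitive L z) (hiso : B z z = 0)
    (I : Submodule ℤ V) (hI : I = Submodule.span ℤ {z}) :
    Nonempty
      (↥(EvenLattice.GammaParabolic B L I) ≃*
        Multiplicative ↥(EvenLattice.perpLattice B L I)
          ⋊[EvenLattice.latticeAction
              (EvenLattice.perpQuotientForm B hB (Submodule.span ℚ (I : Set V)))
              (EvenLattice.perpLattice B L I)]
        ↥(EvenLattice.Gamma
              (EvenLattice.perpQuotientForm B hB (Submodule.span ℚ (I : Set V)))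
              (EvenLattice.perpLattice B L I))) := by
  have hU : Submodule.span ℚ (I : Set V) = Submodule.span ℚ {z} := by
    rw [hI, Submodule.span_span_of_tower]
  obtain ⟨z₀, hz₀, hzz₀⟩ :=
    EvenLattice.exists_dual_pairing_eq_one hB hnd hL.fg hL.span_eq_top hz
  have hz₀z : B z₀ z = 1 := by rw [hB.eq, hzz₀]
  obtain ⟨ι, π, S, hπ⟩ := EvenLattice.exists_hyperbolicSplitting hB
    -- Subtracting `(z₀, z₀)/2 • z` kills the norm of `z₀` and keeps its pairing with `z` equal to
    -- 1.
    (z' := z₀ - (2⁻¹ * B z₀ z₀) • z)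
    hiso (by simp [hzz₀, hiso])
    (by
      simp [hzz₀, hz₀z, hiso]
      ring) _ hU
  have hperp : ∀ v, v ∈ B.orthogonal (Submodule.span ℚ (I : Set V)) → B v z = 0 := by
    intro v hv
    rw [hB.eq]
    exact hv z (hU ▸ Submodule.mem_span_singleton_self z)
  have hdual : (z₀ - (2⁻¹ * B z₀ z₀) • z) + (2⁻¹ * B z₀ z₀) • z ∈ B.dualSubmodule L := by
    rwa [sub_add_cancel]
  have T : EvenLattice.LatticeSplitting B
      (EvenLattice.perpQuotientForm B hB (Submodule.span ℚ (I : Set V))) z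
      (z₀ - (2⁻¹ * B z₀ z₀) • z) ι π L (EvenLattice.perpLattice B L I) := by
    refine ⟨S, hL.even, hz.1, ⟨_, hdual⟩, fun y => ⟨?_, fun hy => ?_⟩⟩
    · rintro ⟨v, hv, rfl⟩
      have hvL : (v : V) ∈ L := hv
      have e : ι (Submodule.Quotient.mk v) = (v : V) - B v (z₀ - (2⁻¹ * B z₀ z₀) • z) • z := by
        rw [← hπ, S.ι_proj_of_perp (hperp v v.2)]
      obtain ⟨n, hn⟩ := EvenLattice.mem_dualSubmodule_iff.1 hz₀ v hvL
      -- As `v` is orthogonal to `z`, the correction term drops out and only the integral pairing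
      -- with `z₀` remains.
      have e' : B v (z₀ - (2⁻¹ * B z₀ z₀) • z) = n := by
        rw [map_sub, map_smul, hperp v v.2, ← hn, hB.eq]
        simp
      change ι (Submodule.Quotient.mk v) ∈ L
      rw [e, e', Int.cast_smul_eq_zsmul]
      exact L.sub_mem hvL (L.smul_mem n hz.1)
    · have hmem : ι y ∈ B.orthogonal (Submodule.span ℚ (I : Set V)) := by
        rw [LinearMap.BilinForm.mem_orthogonal_iff]
        intro u hu
        rw [hU] at hu
        obtain ⟨c, rfl⟩ := Submodule.mem_span_singleton.1 hu
        change B (c • z) (ι y) = 0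
        rw [map_smul, LinearMap.smul_apply, S.zι, smul_zero]
      exact ⟨⟨ι y, hmem⟩, hy, (hπ ⟨ι y, hmem⟩).symm.trans (S.πι y)⟩
  exact T.nonempty_mulEquiv hU
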